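/- Let $d\ge 1$, let $\Omega\subset\mathbb R^d$ be a bounded convex open set with smooth boundary, $T>0$ and $\alpha\in(0,1)$. Write $(\cdot,\cdot)$ and $\|\cdot\|$ for the inner product and norm of $L^2(\Omega)$ (also for vector fields) and $\|u\|_1=(\|u\|^2+\|\nabla u\|^2)^{1/2}$. **Data.** Let $b_2$ (values in $\mathbb R^{d\times d}$, symmetric positive definite), $b_1$ (values in $\mathbb R^d$) and $b_0$ (real-valued) be smooth on $\overline\Omega\times[0,T]\times[0,T]$, and put $$B(t,s,u,v)=(b_2(\cdot,t,s)\nabla u,\nabla v)-(b_1(\cdot,t,s)u,\nabla v)+(b_0(\cdot,t,s)u,v).$$ Assume: (A1) $u_0\in H^2(\Omega)\cap H^1_0(\Omega)$ and $f\in L^\infty(0,T;L^2(\Omega))$, where $f$ has values $f(t)\in L^2(\Omega)$ at every $t$ that are bounded in $L^2(\Omega)$ for $t\in(0,T]$. (A2) $M:[0,\infty)\to\mathbb R$ is Lipschitz with constant $L_M$, there is $m_0>0$ with $M(s)\ge m_0$ for all $s>0$, and $m_0-4L_MK^2>0$, where $K=\|u_0\|_1+\|f\|_{L^\infty(0,T;L^2(\Omega))}$.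 **Scheme.** For $N\ge1$ and $\delta\ge 1$ let $t_n=T(n/N)^\delta$ $(0\le n\le N)$, $\tau_n=t_n-t_{n-1}$ $(1\le n\le N)$, and $$\mathbb D^\alpha_t u^n=\sum_{j=1}^n k_{n,j}(u^j-u^{j-1}),\qquad k_{n,j}=\frac{\tau_j^{-1}}{\Gamma(1-\alpha)}\int_{t_{j-1}}^{t_j}(t_n-s)^{-\alpha}\,ds .$$ Let $X_h\subset H^1_0(\Omega)$ be a finite-dimensional subspace (for instance a conforming finite element space), and let $f_h^n$ be the $L^2$-projection of $f(t_n)$ into $X_h$. A solution of the scheme is a sequence $u_h^0,\dots,u_h^N\in X_h$ (so $u_h^n=0$ on $\partial\Omega$) such that $u_h^0=R_hu_0$, i.e. $(\nabla u_h^0,\nabla v_h)=(\nabla u_0,\nabla v_h)$ for all $v_h\in X_h$, and, for all $v_h\in X_h$, $$(\mathbb D^\alpha_tu_h^1,v_h)+M(\|\nabla u_h^1\|^2)(\nabla u_h^1,\nabla v_h)=(f_h^1,v_h)+\tau_1B(t_1,t_1,u_h^1,v_h),$$ $$(\mathbb D^\alpha_tu_h^n,v_h)+M(\|\nabla\tilde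 u_h^{n-1}\|^2)(\nabla u_h^n,\nabla v_h)=(f_h^n,v_h)+\sum_{j=1}^{n-1}\tau_{j+1}\bar B(t_n,t_j,u_h^j,v_h)\qquad(2\le n\le N),$$ where $\tilde u_h^{n-1}=\bigl(1+\tfrac{\tau_n}{\tau_{n-1}}\bigr)u_h^{n-1}-\tfrac{\tau_n}{\tau_{n-1}}u_h^{n-2}$, and $\bar B(t_n,t_j,u_h^j,v_h)=\tfrac12[B(t_n,t_j,u_h^j,v_h)+B(t_n,t_{j+1},u_h^{j+1},v_h)]$ for $1\le j\le n-2$, while $\bar B(t_n,t_{n-1},u_h^{n-1},v_h)=B(t_n,t_{n-1},u_h^{n-1},v_h)$. **Theorem.** There is $\tau_0>0$, depending only on the data $(\Omega,d,T,\alpha,b_0,b_1,b_2,u_0,f,M,L_M,m_0)$ and not on $N$, $\delta$ or $X_h$, such that whenever $\tau_1\le\tau_0$ the scheme has exactly one solution $(u_h^0,u_h^1,\dots,u_h^N)$. -/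

import Mathlib

open MeasureTheory Set
open scoped ContDiff NNReal ENNReal Topology

noncomputable section

namespace KirchhoffScheme

/-- The space `ℝ^d` with its Euclidean norm. -/
abbrev Space (d : ℕ) : Type := EuclideanSpace ℝ (Fin d)

/-- `Ω` is a bounded convex open set with smooth boundary: near each boundary point, `Ω` is the
negativity set of a smooth function whose derivative does not vanish at that point. -/
structure IsSmoothConvexDomain {d : ℕ} (Ω : Set (Space d)) : Prop where
  isOpen : IsOpen Ω
  convex : Convex ℝ Ω
  bounded : Bornology.IsBounded Ω
  smooth_boundary : ∀ x ∈ frontier Ω, ∃ U ∈ 𝓝 x, ∃ φ : Space d → ℝ,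
    ContDiff ℝ ∞ φ ∧ fderiv ℝ φ x ≠ 0 ∧ Ω ∩ U = {y ∈ U | φ y < 0}

/-- `L²(Ω)`. -/
abbrev L2 {d : ℕ} (Ω : Set (Space d)) : Type := Lp ℝ 2 (volume.restrict Ω)

/-- `L²(Ω; ℝ^d)`. -/
abbrev L2Vec {d : ℕ} (Ω : Set (Space d)) : Type := Lp (Space d) 2 (volume.restrict Ω)

/-- `L²(Ω) × L²(Ω; ℝ^d)` with the Hilbert norm `(‖u‖² + ‖g‖²)^{1/2}`. A function `u` of class `H¹`
is represented in it by the pair `(u, ∇u)`, so that `w.fst` is the function, `w.snd` its weak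
gradient, and `‖w‖` the `H¹(Ω)` norm. -/
abbrev Pair {d : ℕ} (Ω : Set (Space d)) : Type := WithLp 2 (L2 Ω × L2Vec Ω)

/-- Test functions `C_c^∞(Ω)`. -/
structure IsTest {d : ℕ} (Ω : Set (Space d)) (φ : Space d → ℝ) : Prop where
  smooth : ContDiff ℝ ∞ φ
  compact : HasCompactSupport φ
  support : tsupport φ ⊆ Ω

/-- The pairs `(φ, ∇φ)` with `φ ∈ C_c^∞(Ω)`. -/
def testPairs {d : ℕ} (Ω : Set (Space d)) : Set (Pair Ω) :=
  {w | ∃ φ : Space d → ℝ, IsTest Ω φ ∧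
    (w.fst : Space d → ℝ) =ᵐ[volume.restrict Ω] φ ∧
    (w.snd : Space d → Space d) =ᵐ[volume.restrict Ω] gradient φ}

/-- `H¹₀(Ω)`: the closure of `C_c^∞(Ω)` in the `H¹` norm. -/
def H10 {d : ℕ} (Ω : Set (Space d)) : Submodule ℝ (Pair Ω) :=
  (Submodule.span ℝ (testPairs Ω)).topologicalClosure

/-- `g` is the weak gradient of `u` in `Ω`. -/
def IsWeakGradient {d : ℕ} (Ω : Set (Space d)) (u : L2 Ω) (g : L2Vec Ω) : Prop :=
  ∀ φ : Space d → ℝ, IsTest Ω φ →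
    ∫ x in Ω, u x • gradient φ x = -∫ x in Ω, φ x • g x

/-- The pair `w = (u, ∇u)` comes from a function `u ∈ H²(Ω)`: `∇u` is the weak gradient of `u`, and
each first derivative `∂ᵢu` has a weak gradient in `L²`. -/
def MemH2 {d : ℕ} {Ω : Set (Space d)} (w : Pair Ω) : Prop :=
  IsWeakGradient Ω w.fst w.snd ∧
    ∀ i : Fin d, ∃ G : L2Vec Ω,
      IsWeakGradient Ω ((EuclideanSpace.proj i : Space d →L[ℝ] ℝ).compLp w.snd) G

/-- The coefficients `b₂, b₁, b₀` of the memory operator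
`b(x,t,s)u = -∇·(b₂∇u) + ∇·(b₁u) + b₀u`, as functions of `(x,t,s)`. -/
structure MemoryCoeff (d : ℕ) where
  b₂ : Space d → ℝ → ℝ → Matrix (Fin d) (Fin d) ℝ
  b₁ : Space d → ℝ → ℝ → Space d
  b₀ : Space d → ℝ → ℝ → ℝ

/-- The coefficients are smooth on `closure Ω × [0,T] × [0,T]`, and `b₂` is symmetric and positive
definite there. -/
structure MemoryCoeff.IsAdmissible {d : ℕ} (b : MemoryCoeff d) (Ω : Set (Space d)) (T : ℝ) :
    Prop where
  smooth₂ : ∀ i j, ContDiffOn ℝ ∞ (fun p : Space d × ℝ × ℝ => b.b₂ p.1 p.2.1 p.2.2 i j)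
    (closure Ω ×ˢ Icc 0 T ×ˢ Icc 0 T)
  smooth₁ : ContDiffOn ℝ ∞ (fun p : Space d × ℝ × ℝ => b.b₁ p.1 p.2.1 p.2.2)
    (closure Ω ×ˢ Icc 0 T ×ˢ Icc 0 T)
  smooth₀ : ContDiffOn ℝ ∞ (fun p : Space d × ℝ × ℝ => b.b₀ p.1 p.2.1 p.2.2)
    (closure Ω ×ˢ Icc 0 T ×ˢ Icc 0 T)
  posDef : ∀ x ∈ closure Ω, ∀ t ∈ Icc 0 T, ∀ s ∈ Icc 0 T, (b.b₂ x t s).PosDef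

/-- `B(t,s,u,v) = (b₂(·,t,s)∇u, ∇v) - (b₁(·,t,s)u, ∇v) + (b₀(·,t,s)u, v)`. -/
def MemoryCoeff.form {d : ℕ} (b : MemoryCoeff d) {Ω : Set (Space d)} (t s : ℝ) (u v : Pair Ω) : ℝ :=
  (∫ x in Ω, ∑ i, ∑ j, b.b₂ x t s i j * u.snd x j * v.snd x i)
    - (∫ x in Ω, u.fst x * inner ℝ (b.b₁ x t s) (v.snd x))
    + ∫ x in Ω, b.b₀ x t s * u.fst x * v.fst x

/-- The graded mesh `t_n = T (n/N)^δ`. -/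
def node (T δ : ℝ) (N n : ℕ) : ℝ := T * ((n : ℝ) / (N : ℝ)) ^ δ

/-- The time step `τ_n = t_n - t_{n-1}`, for `n ≥ 1`. -/
def step (T δ : ℝ) (N n : ℕ) : ℝ := node T δ N n - node T δ N (n - 1)

/-- The discrete kernel `k_{n,j} = τ_j⁻¹ / Γ(1-α) ∫_{t_{j-1}}^{t_j} (t_n - s)^{-α} ds`, used for
`1 ≤ j ≤ n`. -/
def kernel (α T δ : ℝ) (N n j : ℕ) : ℝ :=
  (step T δ N j)⁻¹ / Real.Gamma (1 - α) *
    ∫ s in (node T δ N (j - 1))..(node T δ N j), (node T δ N n - s) ^ (-α)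

/-- The L1 approximation `∑_{j=1}^n k_{n,j} (u^j - u^{j-1})` of the Caputo derivative of order `α`
at `t_n`. -/
def l1Caputo {V : Type*} [AddCommGroup V] [Module ℝ V] (α T δ : ℝ) (N : ℕ) (u : ℕ → V) (n : ℕ) : V :=
  ∑ j ∈ Finset.Icc 1 n, kernel α T δ N n j • (u j - u (j - 1))

/-- The extrapolation `ũ^{n-1} = (1 + τ_n/τ_{n-1}) u^{n-1} - (τ_n/τ_{n-1}) u^{n-2}`, used for
`n ≥ 2`. -/
def extrapolation {V : Type*} [AddCommGroup V] [Module ℝ V] (T δ : ℝ) (N : ℕ) (u : ℕ → V) (n : ℕ) : V :=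
  (1 + step T δ N n / step T δ N (n - 1)) • u (n - 1)
    - (step T δ N n / step T δ N (n - 1)) • u (n - 2)

/-- `B̄(t_n,t_j,u^j,v)`, for `1 ≤ j ≤ n-1`: the trapezoidal mean for `j ≤ n-2` and the left value
for `j = n-1`. -/
def memoryQuad {d : ℕ} {Ω : Set (Space d)} (b : MemoryCoeff d) (T δ : ℝ) (N : ℕ) (u : ℕ → Pair Ω)
    (n j : ℕ) (v : Pair Ω) : ℝ :=
  if j + 1 = n then b.form (node T δ N n) (node T δ N j) (u j) v
  else (b.form (node T δ N n) (node T δ N j) (u j) v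
    + b.form (node T δ N n) (node T δ N (j + 1)) (u (j + 1)) v) / 2

/-- `u^0, …, u^N` is a solution of the linearized fully discrete L1 Galerkin scheme in the finite
element space `X`. The value of `u n` for `n > N` plays no role. The discrete source `f_h^n` is the
`L²` projection of `f(t_n)` into `X`, that is, `(f_h^n, v) = (f(t_n), v)` for all `v ∈ X`.
The boundary condition is `u^n ∈ X`, for a space `X ⊆ H¹₀(Ω)`. -/
structure IsSchemeSolution {d : ℕ} {Ω : Set (Space d)} (α T : ℝ) (M : ℝ → ℝ) (b : MemoryCoeff d)
    (u₀ : Pair Ω) (f : ℝ → L2 Ω) (N : ℕ) (δ : ℝ) (X : Submodule ℝ (Pair Ω)) (u : ℕ → Pair Ω) :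
    Prop where
  mem : ∀ n ≤ N, u n ∈ X
  /-- `u^0` is the Ritz projection of `u₀` into `X`. -/
  initial : ∀ v ∈ X, inner ℝ (u 0).snd v.snd = inner ℝ u₀.snd v.snd
  /-- The nonlinear first step. -/
  first : ∀ v ∈ X,
    inner ℝ (l1Caputo α T δ N u 1).fst v.fst
        + M (‖(u 1).snd‖ ^ 2) * inner ℝ (u 1).snd v.snd
      = inner ℝ (f (node T δ N 1)) v.fst
        + step T δ N 1 * b.form (node T δ N 1) (node T δ N 1) (u 1) v
  /-- The linearized steps. -/
  next : ∀ n, 2 ≤ n → n ≤ N → ∀ v ∈ X,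
    inner ℝ (l1Caputo α T δ N u n).fst v.fst
        + M (‖(extrapolation T δ N u n).snd‖ ^ 2) * inner ℝ (u n).snd v.snd
      = inner ℝ (f (node T δ N n)) v.fst
        + ∑ j ∈ Finset.Icc 1 (n - 1), step T δ N (j + 1) * memoryQuad b T δ N u n j v

/-- `K = ‖u₀‖₁ + ‖f‖_{L^∞(0,T;L²(Ω))}`. -/
def dataSize {d : ℕ} {Ω : Set (Space d)} (T : ℝ) (u₀ : Pair Ω) (f : ℝ → L2 Ω) : ℝ :=
  ‖u₀‖ + (eLpNorm f ∞ (volume.restrict (Ioo 0 T))).toReal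

end KirchhoffScheme

end

open KirchhoffScheme

/-! The scheme is a recursion, so it is enough that every term is uniquely determined by a valid
history (`exists_unique_history`). On `X` the norm of the gradient controls the full norm, by
Poincaré's inequality with a constant depending only on `Ω` (`norm_le_of_mem_H10`). For `n = 0` and
`n ≥ 2` the unknown enters only through a definite form `k (u, v) + μ (∇u, ∇v)`: the extrapolation
and the memory sum involve earlier terms alone, so these steps are linear and need no smallness.

The first step is nonlinear and contains its memory term implicitly. Testing with the increment `u -
z` from the previous term `z` gives `‖∇u‖² ≤ S` with `S` slightly above `K²`, because the source
contributes `C² / (2 k_{1,1}) = O(τ₁^α)` and the memory term `O(τ₁)` (`IsImplicitStep.norm_sq_le`).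
The nonlinearity depends on `u` through one number only, so existence reduces to a scalar fixed
point, found by the intermediate value theorem after freezing `M s`
(`exists_isImplicitStep_kirchhoff`). Two solutions below the bound coincide once `2 L S + O(τ₁) <
m₀` (`IsImplicitStep.eq_of_kirchhoff`). This is possible because `2 L K² < m₀`, a consequence of the
assumed `4 L K² < m₀`. -/

/-- Finite-dimensional Lax–Milgram: definiteness makes `A : X → X*` injective, hence surjective by
equality of dimensions. -/
theorem exists_forall_apply_eq_of_definite {X : Type*} [AddCommGroup X] [Module ℝ X]
    [FiniteDimensional ℝ X] (A : X →ₗ[ℝ] X →ₗ[ℝ] ℝ) (hA : ∀ v, A v v = 0 → v = 0)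
    (l : X →ₗ[ℝ] ℝ) : ∃ u, ∀ v, A u v = l v := by
  have hinj : Function.Injective A := by
    rw [injective_iff_map_eq_zero]
    intro v hv
    exact hA v (by simp [hv])
  have hsurj : Function.Surjective A :=
    (LinearMap.injective_iff_surjective_of_finrank_eq_finrank
      (f := A) (Subspace.dual_finrank_eq (K := ℝ) (V := X)).symm).1 hinj
  obtain ⟨u, hu⟩ := hsurj l
  exact ⟨u, fun v => by rw [hu]⟩

/-! ### One implicit time step, in abstract form -/

section Abstract

variable {X E F : Type*} [AddCommGroup X] [Module ℝ X]
  [NormedAddCommGroup E] [InnerProductSpace ℝ E] [NormedAddCommGroup F] [InnerProductSpace ℝ F]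

/-- The bilinear form `k (Pu, Pv) + μ (Qu, Qv)`. -/
noncomputable def massStiffness (P : X →ₗ[ℝ] E) (Q : X →ₗ[ℝ] F) (k μ : ℝ) : X →ₗ[ℝ] X →ₗ[ℝ] ℝ :=
  k • (innerₗ E).compl₁₂ P P + μ • (innerₗ F).compl₁₂ Q Q

@[simp]
theorem massStiffness_apply (P : X →ₗ[ℝ] E) (Q : X →ₗ[ℝ] F) (k μ : ℝ) (u v : X) :
    massStiffness P Q k μ u v = k * inner ℝ (P u) (P v) + μ * inner ℝ (Q u) (Q v) := by
  simp [massStiffness]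

/-- The stiffness part dominates `β` on the diagonal, so the difference of the two forms is
definite. Only `Q` has to be injective; `k = 0` is allowed and serves the Ritz projection. -/
theorem exists_massStiffness_eq [FiniteDimensional ℝ X] {P : X →ₗ[ℝ] E} {Q : X →ₗ[ℝ] F}
    (hQ : Function.Injective Q) {k μ ε : ℝ} (hk : 0 ≤ k) (hε : ε < μ)
    {β : X →ₗ[ℝ] X →ₗ[ℝ] ℝ} (hβ : ∀ u v, |β u v| ≤ ε * (‖Q u‖ * ‖Q v‖)) (l : X →ₗ[ℝ] ℝ) :
    ∃ u, ∀ v, k * inner ℝ (P u) (P v) + μ * inner ℝ (Q u) (Q v) = l v + β u v := by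
  obtain ⟨u, hu⟩ := exists_forall_apply_eq_of_definite (massStiffness P Q k μ - β) (by
    intro v hv
    have h1 := (abs_le.1 (hβ v v)).2
    simp only [LinearMap.sub_apply, massStiffness_apply, real_inner_self_eq_norm_sq] at hv
    have h2 : 0 ≤ k * ‖P v‖ ^ 2 := by positivity
    have h3 : ‖Q v‖ ^ 2 = 0 := by
      have : 0 ≤ ‖Q v‖ ^ 2 := sq_nonneg _
      nlinarith
    exact hQ (by rw [map_zero, ← norm_eq_zero]; simpa using h3)) l
  refine ⟨u, fun v => ?_⟩
  have := hu v
  simp only [LinearMap.sub_apply, massStiffness_apply] at this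
  linarith

/-- `u` solves one implicit time step from `z`, with stiffness coefficient `μ`, source `g` and
perturbation `β`. -/
def IsImplicitStep (P : X →ₗ[ℝ] E) (Q : X →ₗ[ℝ] F) (k : ℝ) (β : X →ₗ[ℝ] X →ₗ[ℝ] ℝ) (g : E) (z : X)
    (μ : ℝ) (u : X) : Prop :=
  ∀ v, k * inner ℝ (P (u - z)) (P v) + μ * inner ℝ (Q u) (Q v) = inner ℝ g (P v) + β u v

variable {P : X →ₗ[ℝ] E} {Q : X →ₗ[ℝ] F} {k ε C K S m₀ : ℝ} {β : X →ₗ[ℝ] X →ₗ[ℝ] ℝ} {g : E} {z : X}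

/-- Energy estimate: with the test vector `u - z` the mass term becomes `k ‖P (u - z)‖²`, which
absorbs the source by Young's inequality at the cost `C² / (4 k)`, and the stiffness term polarizes.
-/
theorem IsImplicitStep.norm_sq_le {μ : ℝ} {u : X} (hu : IsImplicitStep P Q k β g z μ u)
    (hk : 0 < k) (hμ : m₀ ≤ μ) (hε : 0 ≤ ε) (hεm : ε < m₀)
    (hβ : ∀ u v, |β u v| ≤ ε * (‖Q u‖ * ‖Q v‖)) (hg : ‖g‖ ≤ C) (hz : ‖Q z‖ ≤ K) (hKS : K ^ 2 ≤ S)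
    (hsmall : C ^ 2 / (2 * k) + ε * S ≤ m₀ * (S - K ^ 2)) : ‖Q u‖ ^ 2 ≤ S := by
  have h := hu (u - z)
  have h1 := (abs_le.1 (hβ u (u - z))).2
  have h2 := real_inner_le_norm g (P (u - z))
  have h3 : 2 * inner ℝ (Q u) (Q (u - z)) = ‖Q u‖ ^ 2 + ‖Q (u - z)‖ ^ 2 - ‖Q z‖ ^ 2 := by
    have : Q z = Q u - Q (u - z) := by simp
    rw [this, norm_sub_sq_real]
    ring
  rw [real_inner_self_eq_norm_sq] at h
  have hz2 : ‖Q z‖ ^ 2 ≤ K ^ 2 := pow_le_pow_left₀ (norm_nonneg _) hz 2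
  have h4 : ‖g‖ * ‖P (u - z)‖ ≤ C ^ 2 / (4 * k) + k * ‖P (u - z)‖ ^ 2 := by
    have h5 : ‖g‖ * ‖P (u - z)‖ ≤ C * ‖P (u - z)‖ := by gcongr
    have h6 : C ^ 2 / (4 * k) + k * ‖P (u - z)‖ ^ 2 - C * ‖P (u - z)‖
        = (C - 2 * k * ‖P (u - z)‖) ^ 2 / (4 * k) := by
      field_simp
      ring
    have h7 : 0 ≤ (C - 2 * k * ‖P (u - z)‖) ^ 2 / (4 * k) := by positivity
    linarith
  have h8 : C ^ 2 / (2 * k) = 2 * (C ^ 2 / (4 * k)) := by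
    field_simp
    ring
  have h9 : 2 * (‖Q u‖ * ‖Q (u - z)‖) ≤ ‖Q u‖ ^ 2 + ‖Q (u - z)‖ ^ 2 := by
    nlinarith [sq_nonneg (‖Q u‖ - ‖Q (u - z)‖)]
  have h10 : ε * (2 * (‖Q u‖ * ‖Q (u - z)‖)) ≤ ε * (‖Q u‖ ^ 2 + ‖Q (u - z)‖ ^ 2) := by gcongr
  have h11 : μ * (‖Q u‖ ^ 2 + ‖Q (u - z)‖ ^ 2 - ‖Q z‖ ^ 2)
      ≤ C ^ 2 / (2 * k) + ε * (‖Q u‖ ^ 2 + ‖Q (u - z)‖ ^ 2) := by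
    rw [← h3]
    linarith
  have h12 : 0 ≤ (μ - ε) * ‖Q (u - z)‖ ^ 2 := mul_nonneg (by linarith) (sq_nonneg _)
  have h13 : m₀ * (S - K ^ 2) ≤ μ * (S - K ^ 2) := by
    apply mul_le_mul_of_nonneg_right hμ
    linarith
  have h14 : μ * ‖Q z‖ ^ 2 ≤ μ * K ^ 2 := mul_le_mul_of_nonneg_left hz2 (by linarith)
  -- After dropping the term in `‖Q (u - z)‖²`, what remains is `C² / (2 k) + μ K² ≤ (μ - ε) S`,
  -- which is `hsmall` with `m₀` replaced by the larger `μ`.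
  have h15 : (μ - ε) * ‖Q u‖ ^ 2 ≤ (μ - ε) * S := by nlinarith
  exact le_of_mul_le_mul_left h15 (by linarith)

/-- Stability in the stiffness coefficient, by testing the difference of the two equations with `u -
w`. It yields both continuity in the frozen coefficient and uniqueness for the nonlinear step. -/
theorem IsImplicitStep.norm_sub_sq_le {μ ν : ℝ} {u w : X} (hu : IsImplicitStep P Q k β g z μ u)
    (hw : IsImplicitStep P Q k β g z ν w) (hk : 0 ≤ k) (hμ : m₀ ≤ μ)
    (hβ : ∀ u v, |β u v| ≤ ε * (‖Q u‖ * ‖Q v‖)) :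
    (m₀ - ε) * ‖Q (u - w)‖ ^ 2 ≤ |μ - ν| * ‖Q w‖ * ‖Q (u - w)‖ := by
  have h1 := hu (u - w)
  have h2 := hw (u - w)
  have h3 := (abs_le.1 (hβ (u - w) (u - w))).2
  have h4 : P (u - z) - P (w - z) = P (u - w) := by
    rw [← map_sub]
    congr 1
    abel
  have h5 : k * ‖P (u - w)‖ ^ 2 + μ * ‖Q (u - w)‖ ^ 2 + (μ - ν) * inner ℝ (Q w) (Q (u - w))
      = β (u - w) (u - w) := by
    have e1 : inner ℝ (P (u - z)) (P (u - w)) - inner ℝ (P (w - z)) (P (u - w))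
        = ‖P (u - w)‖ ^ 2 := by rw [← inner_sub_left, h4, real_inner_self_eq_norm_sq]
    have e2 : inner ℝ (Q u) (Q (u - w)) - inner ℝ (Q w) (Q (u - w)) = ‖Q (u - w)‖ ^ 2 := by
      rw [← inner_sub_left, ← map_sub, real_inner_self_eq_norm_sq]
    have e3 : β u (u - w) - β w (u - w) = β (u - w) (u - w) := by simp
    linear_combination h1 - h2 - k * e1 - μ * e2 + e3
  have h6 : |(μ - ν) * inner ℝ (Q w) (Q (u - w))| ≤ |μ - ν| * ‖Q w‖ * ‖Q (u - w)‖ := by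
    rw [abs_mul, mul_assoc]
    gcongr
    exact abs_real_inner_le_norm _ _
  have h7 := (abs_le.1 h6).1
  have h8 : 0 ≤ k * ‖P (u - w)‖ ^ 2 := by positivity
  have h9 : m₀ * ‖Q (u - w)‖ ^ 2 ≤ μ * ‖Q (u - w)‖ ^ 2 := by gcongr
  nlinarith

variable {M : ℝ → ℝ} {L : ℝ≥0}

/-- The coefficients differ by at most `L (‖Q u‖ + ‖Q w‖) ‖Q (u - w)‖`, so stability gives `(m₀ - ε)
‖Q (u - w)‖² ≤ 2 L S ‖Q (u - w)‖²`, and `hLS` forces the norm to vanish. -/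
theorem IsImplicitStep.eq_of_kirchhoff {u w : X} (hQ : Function.Injective Q)
    (hu : IsImplicitStep P Q k β g z (M (‖Q u‖ ^ 2)) u)
    (hw : IsImplicitStep P Q k β g z (M (‖Q w‖ ^ 2)) w) (hk : 0 ≤ k)
    (hM : LipschitzOnWith L M (Ici 0)) (hMm : ∀ s, 0 ≤ s → m₀ ≤ M s)
    (hβ : ∀ u v, |β u v| ≤ ε * (‖Q u‖ * ‖Q v‖)) (hLS : 2 * L * S + ε < m₀)
    (huS : ‖Q u‖ ^ 2 ≤ S) (hwS : ‖Q w‖ ^ 2 ≤ S) : u = w := by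
  have h1 := hu.norm_sub_sq_le hw hk (hMm _ (sq_nonneg _)) hβ
  have h2 : |M (‖Q u‖ ^ 2) - M (‖Q w‖ ^ 2)| ≤ L * |‖Q u‖ ^ 2 - ‖Q w‖ ^ 2| := by
    simpa only [Real.dist_eq] using hM.dist_le_mul (‖Q u‖ ^ 2) (mem_Ici.2 (sq_nonneg _)) (‖Q w‖ ^ 2)
      (mem_Ici.2 (sq_nonneg _))
  have h3 : |‖Q u‖ ^ 2 - ‖Q w‖ ^ 2| ≤ ‖Q (u - w)‖ * (‖Q u‖ + ‖Q w‖) := by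
    rw [sq_sub_sq, abs_mul, mul_comm, map_sub, abs_of_nonneg (a := ‖Q u‖ + ‖Q w‖) (by positivity)]
    gcongr
    exact abs_norm_sub_norm_le _ _
  have h4 : (‖Q u‖ + ‖Q w‖) * ‖Q w‖ ≤ 2 * S := by
    nlinarith [sq_nonneg (‖Q u‖ - ‖Q w‖)]
  have h5 : |M (‖Q u‖ ^ 2) - M (‖Q w‖ ^ 2)| * ‖Q w‖ * ‖Q (u - w)‖
      ≤ L * (2 * S) * ‖Q (u - w)‖ ^ 2 :=
    calc _ ≤ L * (‖Q (u - w)‖ * (‖Q u‖ + ‖Q w‖)) * ‖Q w‖ * ‖Q (u - w)‖ := by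
          gcongr
          exact h2.trans (by gcongr)
      _ = L * ((‖Q u‖ + ‖Q w‖) * ‖Q w‖) * ‖Q (u - w)‖ ^ 2 := by ring
      _ ≤ _ := by gcongr
  have h6 : ‖Q (u - w)‖ ^ 2 = 0 := by nlinarith [sq_nonneg ‖Q (u - w)‖]
  have h7 : Q (u - w) = 0 := by rw [← norm_eq_zero]; simpa using h6
  exact sub_eq_zero.1 (hQ (by rw [h7, map_zero]))

/-- The nonlocal nonlinear step has a solution: by the intermediate value theorem, the solution
`u_s` of the problem with frozen coefficient `M s` satisfies `‖Q u_s‖ ^ 2 = s` for some `s`. -/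
theorem exists_isImplicitStep_kirchhoff [FiniteDimensional ℝ X] (hQ : Function.Injective Q)
    (hk : 0 < k) (hε : 0 ≤ ε) (hεm : ε < m₀)
    (hM : LipschitzOnWith L M (Ici 0)) (hMm : ∀ s, 0 ≤ s → m₀ ≤ M s)
    (hβ : ∀ u v, |β u v| ≤ ε * (‖Q u‖ * ‖Q v‖)) (hg : ‖g‖ ≤ C) (hz : ‖Q z‖ ≤ K) (hKS : K ^ 2 ≤ S)
    (hsmall : C ^ 2 / (2 * k) + ε * S ≤ m₀ * (S - K ^ 2)) :
    ∃ u, IsImplicitStep P Q k β g z (M (‖Q u‖ ^ 2)) u := by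
  have hex : ∀ s, 0 ≤ s → ∃ u, IsImplicitStep P Q k β g z (M s) u := by
    intro s hs
    obtain ⟨u, hu⟩ := exists_massStiffness_eq (P := P) hQ hk.le (hεm.trans_le (hMm s hs)) hβ
      ((innerₗ E g).comp P + k • (innerₗ E (P z)).comp P)
    refine ⟨u, fun v => ?_⟩
    have := hu v
    simp only [LinearMap.add_apply, LinearMap.comp_apply, LinearMap.smul_apply, smul_eq_mul,
      innerₗ_apply_apply] at this
    rw [map_sub, inner_sub_left]
    linarith
  -- An arbitrary selection suffices: the stability estimate makes `Q ∘ U` Lipschitz on `[0, S]`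
  -- whatever the choice.
  choose! U hU using hex
  have hUS : ∀ s, 0 ≤ s → ‖Q (U s)‖ ^ 2 ≤ S := fun s hs =>
    (hU s hs).norm_sq_le hk (hMm s hs) hε hεm hβ hg hz hKS hsmall
  have hS : 0 ≤ S := (sq_nonneg K).trans hKS
  have hlip : ∀ s ∈ Icc 0 S, ∀ r ∈ Icc 0 S,
      dist (Q (U s)) (Q (U r)) ≤ (L * √S / (m₀ - ε)) * dist s r := by
    intro s hs r hr
    have h1 := (hU s hs.1).norm_sub_sq_le (hU r hr.1) hk.le (hMm s hs.1) hβ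
    have h2 : |M s - M r| ≤ L * |s - r| := by
      simpa only [Real.dist_eq] using hM.dist_le_mul s hs.1 r hr.1
    have h3 : ‖Q (U r)‖ ≤ √S := Real.le_sqrt_of_sq_le (hUS r hr.1)
    rw [dist_eq_norm, ← map_sub, Real.dist_eq, div_mul_eq_mul_div, le_div_iff₀ (by linarith)]
    rcases (norm_nonneg (Q (U s - U r))).eq_or_lt with h0 | h0
    · rw [← h0]
      simp only [zero_mul]
      positivity
    · refine le_of_mul_le_mul_right ?_ h0
      calc ‖Q (U s - U r)‖ * (m₀ - ε) * ‖Q (U s - U r)‖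
          = (m₀ - ε) * ‖Q (U s - U r)‖ ^ 2 := by ring
        _ ≤ |M s - M r| * ‖Q (U r)‖ * ‖Q (U s - U r)‖ := h1
        _ ≤ (L * |s - r|) * √S * ‖Q (U s - U r)‖ := by gcongr
        _ = _ := by ring
  have hcont : ContinuousOn (fun s => Q (U s)) (Icc 0 S) := by
    apply LipschitzOnWith.continuousOn (K := (L * √S / (m₀ - ε)).toNNReal)
    refine LipschitzOnWith.of_dist_le_mul fun s hs r hr => ?_
    rw [Real.coe_toNNReal _ (div_nonneg (by positivity) (by linarith))]
    exact hlip s hs r hr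
  have hivt := intermediate_value_Icc hS
    (f := fun s => s - ‖Q (U s)‖ ^ 2) (continuousOn_id.sub (hcont.norm.pow 2))
  obtain ⟨s, hs, hs0⟩ := hivt (show (0 : ℝ) ∈ _ from
    ⟨by simp, by simpa using hUS S hS⟩)
  refine ⟨U s, ?_⟩
  have : ‖Q (U s)‖ ^ 2 = s := by
    simp only at hs0
    linarith
  rw [this]
  exact hU s hs.1

end Abstract

/-! ### Bilinear forms on `L²` given by bounded coefficients -/

section BilinearIntegral

set_option maxSynthPendingDepth 3

variable {X E F : Type*} [MeasurableSpace X] {μ : Measure X}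
  [NormedAddCommGroup E] [NormedSpace ℝ E] [NormedAddCommGroup F] [NormedSpace ℝ F]

omit [NormedSpace ℝ E] [NormedSpace ℝ F] in
theorem MeasureTheory.Lp.integrable_norm_mul_norm (u : Lp E 2 μ) (v : Lp F 2 μ) :
    Integrable (fun x => ‖u x‖ * ‖v x‖) μ :=
  MemLp.integrable_mul (Lp.memLp u).norm (Lp.memLp v).norm

omit [NormedSpace ℝ E] [NormedSpace ℝ F] in
theorem MeasureTheory.Lp.integral_norm_mul_norm_le (u : Lp E 2 μ) (v : Lp F 2 μ) :
    ∫ x, ‖u x‖ * ‖v x‖ ∂μ ≤ ‖u‖ * ‖v‖ := by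
  have h := real_inner_le_norm ((Lp.memLp u).norm.toLp _) ((Lp.memLp v).norm.toLp _)
  rw [Lp.norm_toLp, Lp.norm_toLp, eLpNorm_norm, eLpNorm_norm, ← Lp.norm_def, ← Lp.norm_def,
    L2.inner_def] at h
  refine le_of_eq_of_le (integral_congr_ae ?_) h
  filter_upwards [(Lp.memLp u).norm.coeFn_toLp, (Lp.memLp v).norm.coeFn_toLp] with x hu hv
  rw [hu, hv]
  simp [mul_comm]

theorem integrable_clm_apply₂ {A : X → E →L[ℝ] F →L[ℝ] ℝ} (hA : AEStronglyMeasurable A μ) {C : ℝ}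
    (hC : ∀ᵐ x ∂μ, ‖A x‖ ≤ C) (u : Lp E 2 μ) (v : Lp F 2 μ) :
    Integrable (fun x => A x (u x) (v x)) μ := by
  have hc : Continuous fun p : (E →L[ℝ] F →L[ℝ] ℝ) × E × F => p.1 p.2.1 p.2.2 := by fun_prop
  refine ((Lp.integrable_norm_mul_norm u v).const_mul C).mono'
    (hc.comp_aestronglyMeasurable
      (hA.prodMk ((Lp.aestronglyMeasurable u).prodMk (Lp.aestronglyMeasurable v)))) ?_
  filter_upwards [hC] with x hx
  refine ((A x).le_opNorm₂ (u x) (v x)).trans ?_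
  rw [mul_assoc]
  gcongr

theorem exists_bilinear_eq_integral {A : X → E →L[ℝ] F →L[ℝ] ℝ} (hA : AEStronglyMeasurable A μ)
    {C : ℝ} (hC : ∀ᵐ x ∂μ, ‖A x‖ ≤ C) (hC0 : 0 ≤ C) :
    ∃ β : Lp E 2 μ →ₗ[ℝ] Lp F 2 μ →ₗ[ℝ] ℝ, (∀ u v, β u v = ∫ x, A x (u x) (v x) ∂μ) ∧
      ∀ u v, |β u v| ≤ C * (‖u‖ * ‖v‖) := by
  have hi := fun u v => integrable_clm_apply₂ hA hC u v
  refine ⟨LinearMap.mk₂ ℝ (fun u v => ∫ x, A x (u x) (v x) ∂μ) ?_ ?_ ?_ ?_, fun _ _ => rfl, ?_⟩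
  · intro u u' v
    rw [← integral_add (hi u v) (hi u' v)]
    refine integral_congr_ae ?_
    filter_upwards [Lp.coeFn_add u u'] with x hx
    rw [hx, Pi.add_apply, map_add, _root_.add_apply]
  · intro c u v
    rw [smul_eq_mul, ← integral_const_mul]
    refine integral_congr_ae ?_
    filter_upwards [Lp.coeFn_smul c u] with x hx
    simp [hx]
  · intro u v v'
    rw [← integral_add (hi u v) (hi u v')]
    refine integral_congr_ae ?_
    filter_upwards [Lp.coeFn_add v v'] with x hx
    rw [hx, Pi.add_apply, map_add]
  · intro c u v
    rw [smul_eq_mul, ← integral_const_mul]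
    refine integral_congr_ae ?_
    filter_upwards [Lp.coeFn_smul c v] with x hx
    simp [hx]
  · intro u v
    rw [LinearMap.mk₂_apply, ← Real.norm_eq_abs]
    calc ‖∫ x, A x (u x) (v x) ∂μ‖ ≤ ∫ x, C * (‖u x‖ * ‖v x‖) ∂μ := by
          refine norm_integral_le_of_norm_le ((Lp.integrable_norm_mul_norm u v).const_mul C) ?_
          filter_upwards [hC] with x hx
          refine ((A x).le_opNorm₂ (u x) (v x)).trans ?_
          rw [mul_assoc]
          gcongr
      _ ≤ C * (‖u‖ * ‖v‖) := by
          rw [integral_const_mul]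
          gcongr
          exact Lp.integral_norm_mul_norm_le u v

/-- Compactness of `closure Ω × s` bounds the coefficient uniformly, so `C` is fixed before the
parameter `y`. This later makes the constant independent of the mesh. -/
theorem exists_bilinear_eq_integral_of_continuousOn {d : ℕ} {Ω : Set (Space d)}
    (hΩ : MeasurableSet Ω) (hb : Bornology.IsBounded Ω) {Y : Type*} [TopologicalSpace Y] {s : Set Y}
    (hs : IsCompact s) {A : Space d → Y → E →L[ℝ] F →L[ℝ] ℝ}
    (hA : ContinuousOn (fun p : Space d × Y => A p.1 p.2) (closure Ω ×ˢ s)) :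
    ∃ C, 0 ≤ C ∧ ∀ y ∈ s, ∃ β : Lp E 2 (volume.restrict Ω) →ₗ[ℝ] Lp F 2 (volume.restrict Ω) →ₗ[ℝ] ℝ,
      (∀ u v, β u v = ∫ x in Ω, A x y (u x) (v x)) ∧ ∀ u v, |β u v| ≤ C * (‖u‖ * ‖v‖) := by
  obtain ⟨C, hC⟩ := (hb.isCompact_closure.prod hs).exists_bound_of_continuousOn
    (E := E →L[ℝ] F →L[ℝ] ℝ) hA
  refine ⟨max C 0, le_max_right _ _, fun y hy => ?_⟩
  refine exists_bilinear_eq_integral (A := fun x => A x y) ?_ ?_ (le_max_right _ _)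
  · have : ContinuousOn (fun x => A x y) Ω :=
      hA.comp (f := fun x => (x, y)) (by fun_prop) fun x hx => ⟨subset_closure hx, hy⟩
    exact this.aestronglyMeasurable hΩ
  · filter_upwards [ae_restrict_mem hΩ] with x hx
    exact (hC (x, y) ⟨subset_closure hx, hy⟩).trans (le_max_left _ _)

end BilinearIntegral

/-! ### Boundedness of the memory form -/

section Memory

set_option maxSynthPendingDepth 3

variable {d : ℕ} {Ω : Set (Space d)}

theorem norm_fst_le_norm (w : Pair Ω) : ‖w.fst‖ ≤ ‖w‖ := by
  have := WithLp.prod_norm_sq_eq_of_L2 w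
  exact le_of_sq_le_sq (by nlinarith [sq_nonneg ‖w.snd‖]) (norm_nonneg _)

theorem norm_snd_le_norm (w : Pair Ω) : ‖w.snd‖ ≤ ‖w‖ := by
  have := WithLp.prod_norm_sq_eq_of_L2 w
  exact le_of_sq_le_sq (by nlinarith [sq_nonneg ‖w.fst‖]) (norm_nonneg _)

/-- The component `w ↦ u` of a pair `w = (u, ∇u)`. -/
noncomputable def fstLinear (Ω : Set (Space d)) : Pair Ω →ₗ[ℝ] L2 Ω where
  toFun w := w.fst
  map_add' _ _ := rfl
  map_smul' _ _ := rfl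

/-- The component `w ↦ ∇u` of a pair `w = (u, ∇u)`. -/
noncomputable def sndLinear (Ω : Set (Space d)) : Pair Ω →ₗ[ℝ] L2Vec Ω where
  toFun w := w.snd
  map_add' _ _ := rfl
  map_smul' _ _ := rfl

@[simp] theorem fstLinear_apply (w : Pair Ω) : fstLinear Ω w = w.fst := rfl
@[simp] theorem sndLinear_apply (w : Pair Ω) : sndLinear Ω w = w.snd := rfl

theorem KirchhoffScheme.MemoryCoeff.IsAdmissible.exists_bilinear_form {b : MemoryCoeff d} {T : ℝ}
    (hb : b.IsAdmissible Ω T) (hΩ : IsSmoothConvexDomain Ω) :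
    ∃ C, 0 ≤ C ∧ ∀ t ∈ Icc 0 T, ∀ s ∈ Icc 0 T, ∃ β : Pair Ω →ₗ[ℝ] Pair Ω →ₗ[ℝ] ℝ,
      (∀ u v, β u v = b.form t s u v) ∧ ∀ u v, |β u v| ≤ C * (‖u‖ * ‖v‖) := by
  have hK : IsCompact (Icc (0 : ℝ) T ×ˢ Icc (0 : ℝ) T) := isCompact_Icc.prod isCompact_Icc
  have hm := hΩ.isOpen.measurableSet
  -- Each of the three terms is written as an operator-valued coefficient, continuous in `(x, t,
  -- s)`; here it is a sum of the rank-one forms `(g, h) ↦ g_j h_i`.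
  obtain ⟨C₂, h₂, H₂⟩ := exists_bilinear_eq_integral_of_continuousOn hm hΩ.bounded hK
    (A := fun x p => ∑ i, ∑ j, b.b₂ x p.1 p.2 i j •
      (EuclideanSpace.proj j : Space d →L[ℝ] ℝ).smulRight (EuclideanSpace.proj i : Space d →L[ℝ] ℝ))
    (continuousOn_finsetSum _ fun i _ => continuousOn_finsetSum _ fun j _ =>
      (hb.smooth₂ i j).continuousOn.smul continuousOn_const)
  obtain ⟨C₁, h₁, H₁⟩ := exists_bilinear_eq_integral_of_continuousOn hm hΩ.bounded hK
    (A := fun x p => ContinuousLinearMap.smulRightL ℝ ℝ (Space d →L[ℝ] ℝ)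
      (ContinuousLinearMap.id ℝ ℝ) (innerSL ℝ (b.b₁ x p.1 p.2)))
    ((ContinuousLinearMap.continuous _).comp_continuousOn
      ((innerSL ℝ).continuous.comp_continuousOn hb.smooth₁.continuousOn))
  obtain ⟨C₀, h₀, H₀⟩ := exists_bilinear_eq_integral_of_continuousOn hm hΩ.bounded hK
    (A := fun x p => b.b₀ x p.1 p.2 • ContinuousLinearMap.mul ℝ ℝ)
    (hb.smooth₀.continuousOn.smul continuousOn_const)
  refine ⟨C₂ + C₁ + C₀, by positivity, fun t ht s hs => ?_⟩
  obtain ⟨β₂, e₂, k₂⟩ := H₂ (t, s) ⟨ht, hs⟩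
  obtain ⟨β₁, e₁, k₁⟩ := H₁ (t, s) ⟨ht, hs⟩
  obtain ⟨β₀, e₀, k₀⟩ := H₀ (t, s) ⟨ht, hs⟩
  refine ⟨β₂.compl₁₂ (sndLinear Ω) (sndLinear Ω) - β₁.compl₁₂ (fstLinear Ω) (sndLinear Ω)
    + β₀.compl₁₂ (fstLinear Ω) (fstLinear Ω), fun u v => ?_, fun u v => ?_⟩
  · simp only [LinearMap.add_apply, LinearMap.sub_apply, LinearMap.compl₁₂_apply, fstLinear_apply,
      sndLinear_apply, e₂, e₁, e₀, MemoryCoeff.form]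
    congr 2
    · congr 1
      ext x
      simp [mul_assoc]
    · ext x
      simp [mul_assoc]
  · simp only [LinearMap.add_apply, LinearMap.sub_apply, LinearMap.compl₁₂_apply, fstLinear_apply,
      sndLinear_apply]
    have i₂ : |β₂ u.snd v.snd| ≤ C₂ * (‖u‖ * ‖v‖) := (k₂ _ _).trans (by
      gcongr <;> exact norm_snd_le_norm _)
    have i₁ : |β₁ u.fst v.snd| ≤ C₁ * (‖u‖ * ‖v‖) := (k₁ _ _).trans (by
      gcongr
      · exact norm_fst_le_norm _
      · exact norm_snd_le_norm _)
    have i₀ : |β₀ u.fst v.fst| ≤ C₀ * (‖u‖ * ‖v‖) := (k₀ _ _).trans (by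
      gcongr <;> exact norm_fst_le_norm _)
    rw [add_mul, add_mul]
    exact (abs_add_le _ _).trans (add_le_add ((abs_sub _ _).trans (add_le_add i₂ i₁)) i₀)

end Memory

/-! ### Poincaré's inequality on `H¹₀(Ω)` -/

section Poincare

set_option maxSynthPendingDepth 3

variable {d : ℕ} {Ω : Set (Space d)}

theorem norm_gradient (φ : Space d → ℝ) (x : Space d) : ‖gradient φ x‖ = ‖fderiv ℝ φ x‖ := by
  simp [gradient]

theorem KirchhoffScheme.IsTest.continuous_gradient {φ : Space d → ℝ} (hφ : IsTest Ω φ) :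
    Continuous (gradient φ) :=
  (LinearIsometryEquiv.continuous _).comp (hφ.smooth.continuous_fderiv (by simp))

theorem KirchhoffScheme.IsTest.hasCompactSupport_gradient {φ : Space d → ℝ} (hφ : IsTest Ω φ) :
    HasCompactSupport (gradient φ) :=
  (hφ.compact.fderiv ℝ).comp_left (g := (InnerProductSpace.toDual ℝ (Space d)).symm) (map_zero _)

theorem KirchhoffScheme.IsTest.eq_zero_of_notMem {φ : Space d → ℝ} (hφ : IsTest Ω φ) {x : Space d}
    (hx : x ∉ Ω) : φ x = 0 :=
  image_eq_zero_of_notMem_tsupport fun h => hx (hφ.support h)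

theorem KirchhoffScheme.IsTest.gradient_eq_zero_of_notMem {φ : Space d → ℝ} (hφ : IsTest Ω φ)
    {x : Space d} (hx : x ∉ Ω) : gradient φ x = 0 := by
  have : fderiv ℝ φ x = 0 :=
    image_eq_zero_of_notMem_tsupport fun h => hx (hφ.support (tsupport_fderiv_subset ℝ h))
  simp [gradient, this]

/-- For a coordinate `ℓ` with `∂ₑℓ = 1`, integration by parts gives `∫ φ² = -∫ 2 φ (∂ₑφ) ℓ`, and
`|ℓ| ≤ R` on `Ω`. -/
theorem KirchhoffScheme.IsTest.poincare (hd : 1 ≤ d) {R : ℝ} (hR : ∀ x ∈ Ω, ‖x‖ ≤ R)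
    {φ : Space d → ℝ} (hφ : IsTest Ω φ) :
    ∫ x in Ω, φ x ^ 2 ≤ 4 * R ^ 2 * ∫ x in Ω, ‖gradient φ x‖ ^ 2 := by
  rw [setIntegral_eq_integral_of_forall_compl_eq_zero
      (fun x hx => by rw [hφ.eq_zero_of_notMem hx]; simp),
    setIntegral_eq_integral_of_forall_compl_eq_zero
      (fun x hx => by rw [hφ.gradient_eq_zero_of_notMem hx]; simp)]
  obtain ⟨ℓ, e, hℓe, hℓ, he⟩ : ∃ (ℓ : Space d →L[ℝ] ℝ) (e : Space d),
      ℓ e = 1 ∧ (∀ x, |ℓ x| ≤ ‖x‖) ∧ ‖e‖ = 1 :=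
    ⟨EuclideanSpace.proj ⟨0, hd⟩, EuclideanSpace.single ⟨0, hd⟩ 1, by simp,
      fun x => PiLp.norm_apply_le x _, by simp⟩
  have hcφ := hφ.smooth.continuous
  have hdiff : Differentiable ℝ φ := hφ.smooth.differentiable (by simp)
  have hcd : Continuous (fderiv ℝ φ) := hφ.smooth.continuous_fderiv (by simp)
  have hfd : ∀ x, fderiv ℝ (fun x => φ x ^ 2) x e = 2 * φ x * fderiv ℝ φ x e := by
    intro x
    rw [fderiv_fun_pow _ (hdiff x)]
    simp
  have hsq : HasCompactSupport fun x => φ x ^ 2 :=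
    hφ.compact.comp_left (g := fun y : ℝ => y ^ 2) (by simp)
  have hI1 : Integrable fun x => φ x ^ 2 :=
    (hcφ.pow 2).integrable_of_hasCompactSupport hsq
  have hsq2 : HasCompactSupport fun x => ‖gradient φ x‖ ^ 2 :=
    hφ.hasCompactSupport_gradient.norm.comp_left (g := fun y : ℝ => y ^ 2) (by simp)
  have hI2 : Integrable fun x => ‖gradient φ x‖ ^ 2 :=
    (hφ.continuous_gradient.norm.pow 2).integrable_of_hasCompactSupport hsq2
  have hc3 : Continuous fun x => 2 * φ x * fderiv ℝ φ x e * ℓ x := by fun_prop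
  have hI3 : Integrable fun x => 2 * φ x * fderiv ℝ φ x e * ℓ x :=
    hc3.integrable_of_hasCompactSupport (((hφ.compact.mul_left).mul_right).mul_right)
  have hparts := integral_mul_fderiv_eq_neg_fderiv_mul_of_integrable (μ := volume)
    (f := fun x => φ x ^ 2) (g := ℓ) (v := e)
    (by simpa only [hfd] using hI3)
    (by simpa [hℓe] using hI1)
    (((hcφ.pow 2).mul ℓ.continuous).integrable_of_hasCompactSupport hsq.mul_right)
    (fun x _ => (hdiff x).pow 2) (fun x _ => ℓ.differentiableAt)
  simp only [ContinuousLinearMap.fderiv, hℓe, mul_one, hfd] at hparts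
  -- Young's inequality weighted so that half of `∫ φ²` is absorbed on the left, whence the factor
  -- `4 R²`.
  have hpt : ∀ x, -(2 * φ x * fderiv ℝ φ x e * ℓ x)
      ≤ (1 / 2) * φ x ^ 2 + 2 * R ^ 2 * ‖gradient φ x‖ ^ 2 := by
    intro x
    by_cases hx : x ∈ Ω
    · have h1 : |fderiv ℝ φ x e| ≤ ‖gradient φ x‖ := by
        rw [norm_gradient]
        simpa [he] using (fderiv ℝ φ x).le_opNorm e
      have h2 : |fderiv ℝ φ x e * ℓ x| ≤ ‖gradient φ x‖ * R := by
        rw [abs_mul]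
        exact mul_le_mul h1 ((hℓ x).trans (hR x hx)) (abs_nonneg _) (norm_nonneg _)
      have h3 : (fderiv ℝ φ x e * ℓ x) ^ 2 ≤ (‖gradient φ x‖ * R) ^ 2 := sq_le_sq' (abs_le.1 h2).1
        (abs_le.1 h2).2
      nlinarith [sq_nonneg (φ x + 2 * (fderiv ℝ φ x e * ℓ x))]
    · rw [hφ.eq_zero_of_notMem hx, hφ.gradient_eq_zero_of_notMem hx]
      simp
  have hle : ∫ x, φ x ^ 2 ≤ ∫ x, ((1 / 2) * φ x ^ 2 + 2 * R ^ 2 * ‖gradient φ x‖ ^ 2) := by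
    rw [hparts, ← integral_neg]
    exact integral_mono hI3.neg ((hI1.const_mul _).add (hI2.const_mul _)) hpt
  rw [integral_add (hI1.const_mul _) (hI2.const_mul _), integral_const_mul, integral_const_mul] at hle
  linarith

theorem MeasureTheory.Lp.norm_sq_eq_integral {X E : Type*} [MeasurableSpace X] {μ : Measure X}
    [NormedAddCommGroup E] [InnerProductSpace ℝ E] (u : Lp E 2 μ) {φ : X → E} (h : u =ᵐ[μ] φ) :
    ‖u‖ ^ 2 = ∫ x, ‖φ x‖ ^ 2 ∂μ := by
  rw [← real_inner_self_eq_norm_sq, L2.inner_def]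
  refine integral_congr_ae ?_
  filter_upwards [h] with x hx
  rw [hx, real_inner_self_eq_norm_sq]

/-- Test pairs already form a subspace, so every element of the span comes from one test function,
to which Poincaré's inequality applies. -/
theorem span_testPairs_subset : (Submodule.span ℝ (testPairs Ω) : Set (Pair Ω)) ⊆ testPairs Ω := by
  intro w hw
  induction hw using Submodule.span_induction with
  | mem w h => exact h
  | zero =>
    refine ⟨0, ⟨contDiff_const, HasCompactSupport.zero, by simp [tsupport]⟩, Lp.coeFn_zero _ _ _, ?_⟩
    refine (Lp.coeFn_zero _ _ _).trans (Filter.Eventually.of_forall fun x => ?_)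
    simp [gradient]
  | add w w' _ _ h h' =>
    obtain ⟨φ, hφ, h1, h2⟩ := h
    obtain ⟨ψ, hψ, k1, k2⟩ := h'
    refine ⟨φ + ψ, ⟨hφ.smooth.add hψ.smooth, hφ.compact.add hψ.compact,
      (tsupport_add φ ψ).trans (union_subset hφ.support hψ.support)⟩,
      (Lp.coeFn_add _ _).trans (h1.add k1), (Lp.coeFn_add _ _).trans ((h2.add k2).trans
      (Filter.Eventually.of_forall fun x => ?_))⟩
    simp [gradient, fderiv_add (hφ.smooth.differentiable (by simp) x)
      (hψ.smooth.differentiable (by simp) x)]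
  | smul c w _ h =>
    obtain ⟨φ, hφ, h1, h2⟩ := h
    refine ⟨c • φ, ⟨hφ.smooth.const_smul c, hφ.compact.smul_left (f := fun _ => c),
      (tsupport_smul_subset_right (fun _ => c) φ).trans hφ.support⟩,
      (Lp.coeFn_smul _ _).trans (h1.const_smul c), (Lp.coeFn_smul _ _).trans
      ((h2.const_smul c).trans (Filter.Eventually.of_forall fun x => ?_))⟩
    simp [gradient, fderiv_const_smul (hφ.smooth.differentiable (by simp) x)]

theorem norm_le_of_mem_H10 (hd : 1 ≤ d) {R : ℝ} (hR : ∀ x ∈ Ω, ‖x‖ ≤ R) {w : Pair Ω}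
    (hw : w ∈ H10 Ω) : ‖w‖ ≤ √(4 * R ^ 2 + 1) * ‖w.snd‖ := by
  have hcl : IsClosed {w : Pair Ω | ‖w‖ ≤ √(4 * R ^ 2 + 1) * ‖w.snd‖} :=
    isClosed_le continuous_norm (continuous_const.mul
      (WithLp.continuous_snd 2 _ _).norm)
  refine closure_minimal ?_ hcl hw
  intro w hw
  obtain ⟨φ, hφ, h1, h2⟩ := span_testPairs_subset hw
  have h := hφ.poincare hd hR
  have e1 := Lp.norm_sq_eq_integral w.fst h1
  simp only [Real.norm_eq_abs, sq_abs] at e1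
  rw [← e1, ← Lp.norm_sq_eq_integral w.snd h2] at h
  have h3 := WithLp.prod_norm_sq_eq_of_L2 w
  show ‖w‖ ≤ _
  refine le_of_sq_le_sq ?_ (by positivity)
  rw [mul_pow, Real.sq_sqrt (by positivity)]
  linarith

end Poincare

/-! ### The graded mesh, the L1 kernel and dependence on the history -/

section Mesh

variable {α T δ : ℝ} {N : ℕ}

theorem node_zero (hδ : 1 ≤ δ) : node T δ N 0 = 0 := by
  simp [node, Real.zero_rpow (by linarith : δ ≠ 0)]

theorem node_strictMono (hT : 0 < T) (hδ : 1 ≤ δ) (hN : 1 ≤ N) : StrictMono (node T δ N) := by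
  intro m n hmn
  have hN' : (0 : ℝ) < N := by exact_mod_cast hN
  have hδ' : 0 < δ := zero_lt_one.trans_le hδ
  unfold node
  gcongr

theorem node_last (hδ : 1 ≤ δ) (hN : 1 ≤ N) : node T δ N N = T := by
  have hN' : (N : ℝ) ≠ 0 := by positivity
  simp [node, div_self hN']

theorem node_mem_Icc (hT : 0 < T) (hδ : 1 ≤ δ) (hN : 1 ≤ N) {n : ℕ} (hn : n ≤ N) :
    node T δ N n ∈ Icc 0 T := by
  have h := (node_strictMono hT hδ hN).monotone
  exact ⟨(node_zero hδ).symm.le.trans (h n.zero_le), (h hn).trans_eq (node_last hδ hN)⟩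

theorem step_pos (hT : 0 < T) (hδ : 1 ≤ δ) (hN : 1 ≤ N) {n : ℕ} (hn : 1 ≤ n) :
    0 < step T δ N n :=
  sub_pos.2 (node_strictMono hT hδ hN (by omega))

/-- Only this diagonal weight multiplies the new unknown; its reciprocal is of order `τ_n^α`, which
makes the source term small in the first step. -/
theorem kernel_self (hα : α ∈ Ioo (0 : ℝ) 1) {n : ℕ} (hn : 0 < step T δ N n) :
    kernel α T δ N n n = step T δ N n ^ (-α) / (Real.Gamma (1 - α) * (1 - α)) := by
  have h1 : 0 < 1 - α := sub_pos.2 hα.2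
  have h2 : -α + 1 ≠ 0 := by linarith
  unfold kernel
  rw [intervalIntegral.integral_comp_sub_left (fun x => x ^ (-α)), sub_self,
    integral_rpow (Or.inl (by linarith [hα.2])), Real.zero_rpow h2,
    show node T δ N n - node T δ N (n - 1) = step T δ N n from rfl, Real.rpow_add_one hn.ne',
    neg_add_eq_sub]
  have := (Real.Gamma_pos_of_pos h1).ne'
  field_simp
  ring

theorem kernel_self_pos (hα : α ∈ Ioo (0 : ℝ) 1) {n : ℕ} (hn : 0 < step T δ N n) :
    0 < kernel α T δ N n n := by
  have h1 : 0 < 1 - α := sub_pos.2 hα.2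
  have := Real.Gamma_pos_of_pos h1
  rw [kernel_self hα hn]
  positivity

variable {V : Type*} [AddCommGroup V] [Module ℝ V]

theorem l1Caputo_congr {u w : ℕ → V} {n : ℕ} (h : ∀ j ≤ n, u j = w j) :
    l1Caputo α T δ N u n = l1Caputo α T δ N w n := by
  refine Finset.sum_congr rfl fun j hj => ?_
  have := (Finset.mem_Icc.1 hj).2
  rw [h j this, h (j - 1) (by omega)]

theorem l1Caputo_update (u : ℕ → V) (n : ℕ) (x : V) :
    l1Caputo α T δ N (Function.update u (n + 1) x) (n + 1) =
      ∑ j ∈ Finset.Icc 1 n, kernel α T δ N (n + 1) j • (u j - u (j - 1))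
        + kernel α T δ N (n + 1) (n + 1) • (x - u n) := by
  unfold l1Caputo
  rw [Finset.sum_Icc_succ_top (by omega)]
  congr 1
  · refine Finset.sum_congr rfl fun j hj => ?_
    have := (Finset.mem_Icc.1 hj).2
    rw [Function.update_of_ne (by omega), Function.update_of_ne (by omega)]
  · simp

theorem extrapolation_congr {u w : ℕ → V} {n : ℕ} (hn : 1 ≤ n) (h : ∀ j < n, u j = w j) :
    extrapolation T δ N u n = extrapolation T δ N w n := by
  unfold extrapolation
  rw [h (n - 1) (by omega), h (n - 2) (by omega)]

theorem memoryQuad_congr {d : ℕ} {Ω : Set (Space d)} {b : MemoryCoeff d} {u w : ℕ → Pair Ω}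
    {n j : ℕ} (h : ∀ j < n, u j = w j) (hj : j + 1 ≤ n) (v : Pair Ω) :
    memoryQuad b T δ N u n j v = memoryQuad b T δ N w n j v := by
  unfold memoryQuad
  split_ifs with hjn
  · rw [h j (by omega)]
  · rw [h j (by omega), h (j + 1) (by omega)]

end Mesh

/-! ### Recursions with uniquely solvable steps -/

/-- A recursion in which every step is uniquely solvable, given a valid history, has exactly one
solution. -/
theorem exists_unique_history {V : Type*} {N : ℕ} {S : ℕ → (ℕ → V) → Prop}
    (hcongr : ∀ n u w, (∀ j ≤ n, u j = w j) → S n u → S n w)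
    (hstep : ∀ n ≤ N, ∀ u, (∀ j < n, S j u) → ∃! x, S n (Function.update u n x)) [Nonempty V] :
    (∃ u, ∀ n ≤ N, S n u) ∧
      ∀ u w, (∀ n ≤ N, S n u) → (∀ n ≤ N, S n w) → ∀ n ≤ N, u n = w n := by
  constructor
  · have : ∀ n ≤ N + 1, ∃ u, ∀ j < n, S j u := by
      intro n
      induction n with
      | zero => exact fun _ => ⟨fun _ => Classical.arbitrary V, by simp⟩
      | succ n ih =>
        intro hn
        obtain ⟨u, hu⟩ := ih (by omega)
        obtain ⟨x, hx, -⟩ := hstep n (by omega) u hu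
        refine ⟨Function.update u n x, fun j hj => ?_⟩
        rcases Nat.lt_succ_iff_lt_or_eq.1 hj with h | rfl
        · exact hcongr j u _ (fun i hi => (Function.update_of_ne (by omega) _ _).symm) (hu j h)
        · exact hx
    obtain ⟨u, hu⟩ := this (N + 1) le_rfl
    exact ⟨u, fun n hn => hu n (by omega)⟩
  · intro u w hu hw n
    induction n using Nat.strong_induction_on with
    | _ n ih =>
      intro hn
      -- By induction `w` agrees with `u` before `n`, so `u n` and `w n` both continue the same
      -- history `u`.
      refine (hstep n hn u fun j hj => hu j (by omega)).unique ?_ ?_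
      · simpa using hu n hn
      · refine hcongr n w _ (fun j hj => ?_) (hw n hn)
        rcases hj.lt_or_eq with h | rfl
        · rw [Function.update_of_ne h.ne, ih j h (by omega)]
        · simp

/-! ### Unique solvability of each step of the scheme -/

section Scheme

set_option maxSynthPendingDepth 3

variable {d : ℕ} {Ω : Set (Space d)}

/-- The requirements of the scheme on the `n`-th term of the sequence `u`. -/
def IsSchemeStep (α T : ℝ) (M : ℝ → ℝ) (b : MemoryCoeff d) (u₀ : Pair Ω) (f : ℝ → L2 Ω) (N : ℕ)
    (δ : ℝ) (X : Submodule ℝ (Pair Ω)) (n : ℕ) (u : ℕ → Pair Ω) : Prop :=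
  u n ∈ X ∧ (n = 0 → ∀ v ∈ X, inner ℝ (u 0).snd v.snd = inner ℝ u₀.snd v.snd) ∧
    (n = 1 → ∀ v ∈ X, inner ℝ (l1Caputo α T δ N u 1).fst v.fst
        + M (‖(u 1).snd‖ ^ 2) * inner ℝ (u 1).snd v.snd
      = inner ℝ (f (node T δ N 1)) v.fst
        + step T δ N 1 * b.form (node T δ N 1) (node T δ N 1) (u 1) v) ∧
    (2 ≤ n → ∀ v ∈ X, inner ℝ (l1Caputo α T δ N u n).fst v.fst
        + M (‖(extrapolation T δ N u n).snd‖ ^ 2) * inner ℝ (u n).snd v.snd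
      = inner ℝ (f (node T δ N n)) v.fst
        + ∑ j ∈ Finset.Icc 1 (n - 1), step T δ N (j + 1) * memoryQuad b T δ N u n j v)

variable {α T : ℝ} {M : ℝ → ℝ} {b : MemoryCoeff d} {u₀ : Pair Ω} {f : ℝ → L2 Ω} {N : ℕ} {δ : ℝ}
  {X : Submodule ℝ (Pair Ω)}

theorem isSchemeSolution_iff (hN : 1 ≤ N) {u : ℕ → Pair Ω} :
    IsSchemeSolution α T M b u₀ f N δ X u ↔ ∀ n ≤ N, IsSchemeStep α T M b u₀ f N δ X n u := by
  constructor
  · intro h n hn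
    exact ⟨h.mem n hn, fun _ => h.initial, fun _ => h.first, fun h2 => h.next n h2 hn⟩
  · intro h
    exact ⟨fun n hn => (h n hn).1, (h 0 N.zero_le).2.1 rfl, (h 1 hN).2.2.1 rfl,
      fun n h2 hn => (h n hn).2.2.2 h2⟩

theorem IsSchemeStep.congr {n : ℕ} {u w : ℕ → Pair Ω} (h : ∀ j ≤ n, u j = w j)
    (hu : IsSchemeStep α T M b u₀ f N δ X n u) : IsSchemeStep α T M b u₀ f N δ X n w := by
  obtain ⟨h1, h2, h3, h4⟩ := hu
  refine ⟨h n le_rfl ▸ h1, ?_, ?_, ?_⟩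
  · rintro rfl
    rw [← h 0 le_rfl]
    exact h2 rfl
  · rintro rfl v hv
    rw [← l1Caputo_congr h, ← h 1 le_rfl]
    exact h3 rfl v hv
  · intro hn v hv
    rw [← l1Caputo_congr h, ← h n le_rfl,
      ← extrapolation_congr (by omega) fun j hj => h j hj.le, h4 hn v hv]
    congr 1
    refine Finset.sum_congr rfl fun j hj => ?_
    have := (Finset.mem_Icc.1 hj).2
    rw [memoryQuad_congr (fun j hj => h j hj.le) (by omega)]

theorem existsUnique_massStiffness [FiniteDimensional ℝ X]
    (hX : Function.Injective ((sndLinear Ω).domRestrict X)) {k μ : ℝ} (hk : 0 ≤ k) (hμ : 0 < μ)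
    (l : Pair Ω →ₗ[ℝ] ℝ) :
    ∃! x, x ∈ X ∧ ∀ v ∈ X, k * inner ℝ x.fst v.fst + μ * inner ℝ x.snd v.snd = l v := by
  obtain ⟨x, hx⟩ := exists_massStiffness_eq (P := (fstLinear Ω).domRestrict X) hX hk hμ
    (β := 0) (by simp) (l.domRestrict X)
  have hx' : ∀ v ∈ X, k * inner ℝ (x : Pair Ω).fst v.fst + μ * inner ℝ (x : Pair Ω).snd v.snd
      = l v := fun v hv => by simpa using hx ⟨v, hv⟩
  refine ⟨x, ⟨x.2, hx'⟩, fun y hy => ?_⟩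
  have hmem : y - x ∈ X := X.sub_mem hy.1 x.2
  have h1 := (hy.2 _ hmem).trans (hx' _ hmem).symm
  have h2 : k * ‖(y - x : Pair Ω).fst‖ ^ 2 + μ * ‖(y - x : Pair Ω).snd‖ ^ 2 = 0 := by
    have e1 : ‖(y - x : Pair Ω).fst‖ ^ 2
        = inner ℝ y.fst (y - x : Pair Ω).fst - inner ℝ (x : Pair Ω).fst (y - x : Pair Ω).fst := by
      rw [← inner_sub_left, ← WithLp.sub_fst, real_inner_self_eq_norm_sq]
    have e2 : ‖(y - x : Pair Ω).snd‖ ^ 2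
        = inner ℝ y.snd (y - x : Pair Ω).snd - inner ℝ (x : Pair Ω).snd (y - x : Pair Ω).snd := by
      rw [← inner_sub_left, ← WithLp.sub_snd, real_inner_self_eq_norm_sq]
    rw [e1, e2]
    linarith
  have h3 : ‖(y - x : Pair Ω).snd‖ ^ 2 = 0 := by
    have : 0 ≤ k * ‖(y - x : Pair Ω).fst‖ ^ 2 := by positivity
    have : 0 ≤ μ * ‖(y - x : Pair Ω).snd‖ ^ 2 := by positivity
    have : μ * ‖(y - x : Pair Ω).snd‖ ^ 2 = 0 := by linarith
    simpa [hμ.ne'] using this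
  have h4 : (sndLinear Ω).domRestrict X ⟨y - x, hmem⟩ = 0 := by
    rw [LinearMap.domRestrict_apply, sndLinear_apply, ← norm_eq_zero]
    simpa using h3
  have h5 := congrArg Subtype.val (hX (h4.trans (map_zero _).symm))
  exact sub_eq_zero.1 h5

theorem existsUnique_isSchemeStep_zero [FiniteDimensional ℝ X]
    (hX : Function.Injective ((sndLinear Ω).domRestrict X)) (u : ℕ → Pair Ω) :
    ∃! x, IsSchemeStep α T M b u₀ f N δ X 0 (Function.update u 0 x) := by
  refine (existsUnique_congr fun x => ?_).1 (existsUnique_massStiffness hX le_rfl one_pos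
    ((innerₗ (L2Vec Ω) u₀.snd).comp (sndLinear Ω)))
  simp [IsSchemeStep]

/-- Linearity in `v` requires integrability, which is available because all nodes up to `N` lie in
`[0, T]`. -/
theorem exists_linear_memoryQuad (hb : b.IsAdmissible Ω T) (hΩ : IsSmoothConvexDomain Ω)
    (hT : 0 < T) (hδ : 1 ≤ δ) (hN : 1 ≤ N) (u : ℕ → Pair Ω) {n j : ℕ} (hn : n ≤ N)
    (hj : j + 1 ≤ n) : ∃ l : Pair Ω →ₗ[ℝ] ℝ, ∀ v, l v = memoryQuad b T δ N u n j v := by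
  obtain ⟨C, -, hC⟩ := hb.exists_bilinear_form hΩ
  have hnode : ∀ m ≤ n, node T δ N m ∈ Icc 0 T := fun m hm =>
    node_mem_Icc hT hδ hN (hm.trans hn)
  obtain ⟨β, hβ, -⟩ := hC _ (hnode n le_rfl) _ (hnode j (by omega))
  obtain ⟨β', hβ', -⟩ := hC _ (hnode n le_rfl) _ (hnode (j + 1) hj)
  by_cases h : j + 1 = n
  · exact ⟨β (u j), fun v => by rw [memoryQuad, if_pos h, hβ]⟩
  · refine ⟨(2 : ℝ)⁻¹ • (β (u j) + β' (u (j + 1))), fun v => ?_⟩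
    rw [memoryQuad, if_neg h, LinearMap.smul_apply, LinearMap.add_apply, hβ, hβ', smul_eq_mul]
    ring

theorem existsUnique_isSchemeStep_of_two_le [FiniteDimensional ℝ X]
    (hX : Function.Injective ((sndLinear Ω).domRestrict X)) (hb : b.IsAdmissible Ω T)
    (hΩ : IsSmoothConvexDomain Ω) (hα : α ∈ Ioo (0 : ℝ) 1) (hT : 0 < T) (hδ : 1 ≤ δ) (hN : 1 ≤ N)
    (hM : ∀ s, 0 ≤ s → 0 < M s) {n : ℕ} (h2 : 2 ≤ n) (hn : n ≤ N) (u : ℕ → Pair Ω) :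
    ∃! x, IsSchemeStep α T M b u₀ f N δ X n (Function.update u n x) := by
  have hl : ∀ j, ∃ l : Pair Ω →ₗ[ℝ] ℝ, j + 1 ≤ n → ∀ v, l v = memoryQuad b T δ N u n j v := by
    intro j
    by_cases hj : j + 1 ≤ n
    · obtain ⟨l, hl⟩ := exists_linear_memoryQuad hb hΩ hT hδ hN u hn hj
      exact ⟨l, fun _ => hl⟩
    -- A default functional for indices that do not occur in the memory sum.
    · exact ⟨0, fun h => absurd h hj⟩
  choose l hl using hl
  obtain ⟨m, rfl⟩ : ∃ m, n = m + 1 := ⟨n - 1, by omega⟩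
  -- `R` is the history part of the discrete Caputo derivative; it moves to the right-hand side.
  let R : Pair Ω := ∑ j ∈ Finset.Icc 1 m, kernel α T δ N (m + 1) j • (u j - u (j - 1))
  let k := kernel α T δ N (m + 1) (m + 1)
  have hk : 0 < k := kernel_self_pos hα (step_pos hT hδ hN (by omega))
  refine (existsUnique_congr fun x => ?_).1 (existsUnique_massStiffness hX hk.le
    (hM (‖(extrapolation T δ N u (m + 1)).snd‖ ^ 2) (sq_nonneg _))
    ((innerₗ (L2 Ω) (f (node T δ N (m + 1)))).comp (fstLinear Ω)
      + ∑ j ∈ Finset.Icc 1 m, step T δ N (j + 1) • l j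
      + k • (innerₗ (L2 Ω) (u m).fst).comp (fstLinear Ω)
      - (innerₗ (L2 Ω) R.fst).comp (fstLinear Ω)))
  have hupd : ∀ j < m + 1, Function.update u (m + 1) x j = u j := fun j hj =>
    Function.update_of_ne hj.ne _ _
  have hsum : ∀ v, ∑ j ∈ Finset.Icc 1 (m + 1 - 1),
      step T δ N (j + 1) * memoryQuad b T δ N (Function.update u (m + 1) x) (m + 1) j v
      = ∑ j ∈ Finset.Icc 1 m, step T δ N (j + 1) * l j v := by
    intro v
    refine Finset.sum_congr rfl fun j hj => ?_
    have := (Finset.mem_Icc.1 hj).2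
    rw [memoryQuad_congr hupd (by omega), hl j (by omega)]
  have hcap : ∀ v : Pair Ω,
      inner ℝ (l1Caputo α T δ N (Function.update u (m + 1) x) (m + 1)).fst v.fst
      = inner ℝ R.fst v.fst + k * (inner ℝ x.fst v.fst - inner ℝ (u m).fst v.fst) := by
    intro v
    rw [l1Caputo_update, WithLp.add_fst, WithLp.smul_fst, WithLp.sub_fst, inner_add_left,
      real_inner_smul_left, inner_sub_left]
  unfold IsSchemeStep
  simp only [Function.update_self, hsum, hcap, extrapolation_congr (by omega) hupd]
  refine and_congr_right fun _ => ?_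
  have e0 : m + 1 ≠ 0 := by omega
  have e1 : m + 1 ≠ 1 := by omega
  simp only [e0, e1, h2, false_imp_iff, true_imp_iff, true_and, LinearMap.add_apply,
    LinearMap.sub_apply, LinearMap.sum_apply, LinearMap.smul_apply, LinearMap.comp_apply,
    innerₗ_apply_apply, fstLinear_apply, smul_eq_mul]
  refine forall₂_congr fun v _ => ?_
  constructor <;> intro h <;> linarith

/-- Test with `x` itself and apply Cauchy–Schwarz; this bounds the initial gradient independently of
`X`. -/
theorem norm_snd_le_of_ritz {x : Pair Ω} (hx : x ∈ X)
    (h : ∀ v ∈ X, inner ℝ x.snd v.snd = inner ℝ u₀.snd v.snd) : ‖x.snd‖ ≤ ‖u₀.snd‖ := by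
  have h1 := h x hx
  have h2 := real_inner_le_norm u₀.snd x.snd
  rw [real_inner_self_eq_norm_sq] at h1
  rcases (norm_nonneg x.snd).eq_or_lt with h0 | h0
  · rw [← h0]
    exact norm_nonneg _
  · exact le_of_mul_le_mul_right (by rw [← sq]; linarith) h0

theorem existsUnique_isSchemeStep_one [FiniteDimensional ℝ X]
    (hX : Function.Injective ((sndLinear Ω).domRestrict X)) {L : ℝ≥0} {m₀ C D K S : ℝ}
    (hk : 0 < kernel α T δ N 1 1) (hτ : 0 ≤ step T δ N 1) (hD : 0 ≤ D)
    {β : Pair Ω →ₗ[ℝ] Pair Ω →ₗ[ℝ] ℝ}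
    (hβ : ∀ u v, β u v = b.form (node T δ N 1) (node T δ N 1) u v)
    (hβD : ∀ u ∈ X, ∀ v ∈ X, |β u v| ≤ D * (‖u.snd‖ * ‖v.snd‖))
    (hM : LipschitzOnWith L M (Ici 0)) (hMm : ∀ s, 0 ≤ s → m₀ ≤ M s)
    (hf : ‖f (node T δ N 1)‖ ≤ C) (hK : ‖u₀.snd‖ ≤ K) (hKS : K ^ 2 ≤ S)
    (hsmall : C ^ 2 / (2 * kernel α T δ N 1 1) + step T δ N 1 * D * S ≤ m₀ * (S - K ^ 2))
    (hLS : 2 * L * S + step T δ N 1 * D < m₀) {u : ℕ → Pair Ω}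
    (hu : IsSchemeStep α T M b u₀ f N δ X 0 u) :
    ∃! x, IsSchemeStep α T M b u₀ f N δ X 1 (Function.update u 1 x) := by
  let P := (fstLinear Ω).domRestrict X
  let Q := (sndLinear Ω).domRestrict X
  let γ : X →ₗ[ℝ] X →ₗ[ℝ] ℝ := step T δ N 1 • β.compl₁₂ X.subtype X.subtype
  let z : X := ⟨u 0, hu.1⟩
  have hγ : ∀ x y, |γ x y| ≤ step T δ N 1 * D * (‖Q x‖ * ‖Q y‖) := by
    intro x y
    have : γ x y = step T δ N 1 * β x y := rfl
    rw [this, abs_mul, abs_of_nonneg hτ, mul_assoc]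
    gcongr
    exact hβD x x.2 y y.2
  have hz : ‖Q z‖ ≤ K := (norm_snd_le_of_ritz hu.1 (hu.2.1 rfl)).trans hK
  have hε : 0 ≤ step T δ N 1 * D := mul_nonneg hτ hD
  have hS : 0 ≤ S := (sq_nonneg K).trans hKS
  have hεm : step T δ N 1 * D < m₀ := by
    have : 0 ≤ 2 * (L : ℝ) * S := by positivity
    linarith
  -- The first step is the abstract implicit step on `X` with perturbation `τ₁ B(t₁, t₁, ·, ·)`, so
  -- `ε = τ₁ D`.
  have hiff : ∀ x : X, IsImplicitStep P Q (kernel α T δ N 1 1) γ (f (node T δ N 1)) z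
      (M (‖Q x‖ ^ 2)) x ↔ IsSchemeStep α T M b u₀ f N δ X 1 (Function.update u 1 (x : Pair Ω)) := by
    intro x
    have hcap : ∀ v : Pair Ω,
        inner ℝ (l1Caputo α T δ N (Function.update u 1 (x : Pair Ω)) 1).fst v.fst
        = kernel α T δ N 1 1 * inner ℝ ((x : Pair Ω) - u 0).fst v.fst := by
      intro v
      have := l1Caputo_update (α := α) (T := T) (δ := δ) (N := N) u 0 (x : Pair Ω)
      simp only [zero_add, Finset.Icc_eq_empty_of_lt zero_lt_one, Finset.sum_empty] at this
      rw [this, WithLp.smul_fst, real_inner_smul_left]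
    unfold IsSchemeStep
    simp only [Function.update_self, hcap, SetLike.coe_mem, one_ne_zero, false_imp_iff,
      true_imp_iff, true_and, show ¬ (2 ≤ 1) by omega, and_true, ← hβ]
    exact ⟨fun h v hv => h ⟨v, hv⟩, fun h v => h v v.2⟩
  have hX' : Function.Injective Q := hX
  obtain ⟨x, hx⟩ := exists_isImplicitStep_kirchhoff (P := P) (z := z) hX' hk hε hεm hM hMm hγ hf hz
    hKS hsmall
  refine ⟨x, (hiff x).1 hx, fun y hy => ?_⟩
  have hyX : y ∈ X := by simpa using hy.1
  have hy' := (hiff ⟨y, hyX⟩).2 hy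
  have := hy'.eq_of_kirchhoff hX' hx hk.le hM hMm hγ hLS
    (hy'.norm_sq_le hk (hMm _ (sq_nonneg _)) hε hεm hγ hf hz hKS hsmall)
    (hx.norm_sq_le hk (hMm _ (sq_nonneg _)) hε hεm hγ hf hz hKS hsmall)
  exact congrArg Subtype.val this

end Scheme

/-! ### The threshold for the first step size -/

theorem exists_forall_pos_le_rpow_lt {α : ℝ} (hα : 0 < α) (A B B' : ℝ) {c c' : ℝ} (hc : 0 < c)
    (hc' : 0 < c') : ∃ τ₀ > 0, ∀ τ, 0 < τ → τ ≤ τ₀ → A * τ ^ α + B * τ < c ∧ B' * τ < c' := by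
  have h1 : ContinuousAt (fun τ : ℝ => A * τ ^ α + B * τ) 0 :=
    (continuousAt_const.mul (Real.continuousAt_rpow_const 0 α (Or.inr hα.le))).add
      (continuousAt_const.mul continuousAt_id)
  have h2 : ContinuousAt (fun τ : ℝ => B' * τ) 0 := continuousAt_const.mul continuousAt_id
  have e1 := h1.eventually_lt_const (show A * (0 : ℝ) ^ α + B * 0 < c by
    simpa [Real.zero_rpow hα.ne'])
  have e2 := h2.eventually_lt_const (show B' * 0 < c' by simpa)
  obtain ⟨ε, hε, h⟩ := Metric.eventually_nhds_iff.1 (e1.and e2)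
  refine ⟨ε / 2, by positivity, fun τ h0 hτ => h ?_⟩
  rw [Real.dist_eq, sub_zero, abs_of_pos h0]
  linarith

/-- Continuity extends the lower bound to `s = 0`, a value that occurs when a discrete gradient
vanishes. -/
theorem LipschitzOnWith.le_of_forall_pos {M : ℝ → ℝ} {L : ℝ≥0} (hM : LipschitzOnWith L M (Ici 0))
    {m₀ : ℝ} (h : ∀ s, 0 < s → m₀ ≤ M s) {s : ℝ} (hs : 0 ≤ s) : m₀ ≤ M s := by
  rcases hs.eq_or_lt with rfl | hs
  · have h1 : Filter.Tendsto M (𝓝[>] 0) (𝓝 (M 0)) :=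
      (hM.continuousOn 0 self_mem_Ici).mono_left (nhdsWithin_mono _ Ioi_subset_Ici_self)
    refine ge_of_tendsto h1 ?_
    filter_upwards [self_mem_nhdsWithin] with s hs using h s hs
  · exact h s hs

theorem mainTheorem10 {d : ℕ} (hd : 1 ≤ d) {Ω : Set (Space d)} (hΩ : IsSmoothConvexDomain Ω)
    {α T : ℝ} (hα : α ∈ Ioo (0 : ℝ) 1) (hT : 0 < T)
    (b : MemoryCoeff d) (hb : b.IsAdmissible Ω T)
    (u₀ : Pair Ω) (hu₀ : u₀ ∈ H10 Ω) (hu₀' : MemH2 u₀)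
    (f : ℝ → L2 Ω) (hf : MemLp f ∞ (volume.restrict (Ioo 0 T)))
    (hf' : ∃ C : ℝ, ∀ t ∈ Ioc 0 T, ‖f t‖ ≤ C)
    (M : ℝ → ℝ) (L : ℝ≥0) (hML : LipschitzOnWith L M (Ici 0))
    (m₀ : ℝ) (hm₀ : 0 < m₀) (hMm₀ : ∀ s, 0 < s → m₀ ≤ M s)
    (hsmall : 0 < m₀ - 4 * (L : ℝ) * dataSize T u₀ f ^ 2) :
    ∃ τ₀ : ℝ, 0 < τ₀ ∧
      ∀ (N : ℕ) (δ : ℝ), 1 ≤ N → 1 ≤ δ → step T δ N 1 ≤ τ₀ →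
      ∀ X : Submodule ℝ (Pair Ω), X ≤ H10 Ω → FiniteDimensional ℝ X →
        (∃ u : ℕ → Pair Ω, IsSchemeSolution α T M b u₀ f N δ X u) ∧
        ∀ u w : ℕ → Pair Ω, IsSchemeSolution α T M b u₀ f N δ X u →
          IsSchemeSolution α T M b u₀ f N δ X w → ∀ n ≤ N, u n = w n := by
  -- The energy estimate uses the point value `f (t₁)`, which the essential supremum in `K` does not
  -- control; hence the separate bound `C`.
  obtain ⟨C, hC⟩ := hf'
  obtain ⟨R, hR⟩ := hΩ.bounded.exists_norm_le
  obtain ⟨B, hB0, hB⟩ := hb.exists_bilinear_form hΩ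
  have hM : ∀ s, 0 ≤ s → m₀ ≤ M s := fun s hs => hML.le_of_forall_pos hMm₀ hs
  set K := dataSize T u₀ f
  have hK : ‖u₀.snd‖ ≤ K := (norm_snd_le_norm u₀).trans (le_add_of_nonneg_right ENNReal.toReal_nonneg)
  set p := √(4 * R ^ 2 + 1)
  have hp : 0 ≤ p := Real.sqrt_nonneg _
  -- `B` bounds the memory form by full norms; two uses of Poincaré's inequality turn these into
  -- gradient norms.
  let D := B * p ^ 2
  have hD : 0 ≤ D := by positivity
  have hLK : 0 ≤ (L : ℝ) * K ^ 2 := by positivity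
  obtain ⟨η, hη, hLη⟩ : ∃ η : ℝ, 0 < η ∧ 2 * L * (K ^ 2 + η) < m₀ := by
    have hg : 0 < m₀ - 2 * L * K ^ 2 := by linarith
    -- With this `η`, `2 L η` is the gap `m₀ - 2 L K²` times `L / (L + 1) < 1`; the `+ 1` covers `L
    -- = 0`.
    refine ⟨(m₀ - 2 * L * K ^ 2) / (2 * (L + 1)), by positivity, ?_⟩
    have h1 : 2 * L * ((m₀ - 2 * L * K ^ 2) / (2 * (L + 1)))
        = (m₀ - 2 * L * K ^ 2) * (L / (L + 1)) := by
      field_simp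
    have h2 : (L : ℝ) / (L + 1) < 1 := (div_lt_one (by positivity)).2 (by linarith)
    have h3 := mul_lt_mul_of_pos_left h2 hg
    rw [mul_add, h1]
    linarith
  set S := K ^ 2 + η
  set G := Real.Gamma (1 - α) * (1 - α)
  have hG : 0 < G := mul_pos (Real.Gamma_pos_of_pos (sub_pos.2 hα.2)) (sub_pos.2 hα.2)
  -- The first inequality is the a priori bound with `1 / k_{1,1} = G τ₁^α`, the second is the
  -- uniqueness condition; neither involves `N`, `δ` or `X`.
  obtain ⟨τ₀, hτ₀, hτ⟩ := exists_forall_pos_le_rpow_lt hα.1 (C ^ 2 * G / 2) (D * S) D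
    (show 0 < m₀ * (S - K ^ 2) by simp only [S]; ring_nf; positivity) (sub_pos.2 hLη)
  refine ⟨τ₀, hτ₀, fun N δ hN hδ hstep X hX hfin => ?_⟩
  have hτ1 : 0 < step T δ N 1 := step_pos hT hδ hN le_rfl
  have hPoinc : ∀ v ∈ X, ‖v‖ ≤ p * ‖v.snd‖ := fun v hv => norm_le_of_mem_H10 hd hR (hX hv)
  have hinj : Function.Injective ((sndLinear Ω).domRestrict X) := by
    rw [injective_iff_map_eq_zero]
    intro v hv
    have h1 := hPoinc v v.2
    have h2 : (v : Pair Ω).snd = 0 := hv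
    rw [h2, norm_zero, mul_zero] at h1
    exact Subtype.ext (norm_le_zero_iff.1 h1)
  obtain ⟨k1, k2⟩ := hτ _ hτ1 hstep
  have hker : C ^ 2 / (2 * kernel α T δ N 1 1) = C ^ 2 * G / 2 * step T δ N 1 ^ α := by
    rw [kernel_self hα hτ1, Real.rpow_neg hτ1.le]
    have := Real.rpow_pos_of_pos hτ1 α
    rw [show Real.Gamma (1 - α) * (1 - α) = G from rfl]
    field_simp
  simp only [isSchemeSolution_iff hN]
  refine exists_unique_history (fun n u w h hu => hu.congr h) fun n hn u hu => ?_
  rcases n with _ | _ | n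
  · exact existsUnique_isSchemeStep_zero hinj u
  · have hnode := node_mem_Icc hT hδ hN hN
    have hnode0 : 0 < node T δ N 1 := by
      simpa [step, node_zero hδ] using hτ1
    obtain ⟨β, hβ, hβB⟩ := hB _ hnode _ hnode
    refine existsUnique_isSchemeStep_one hinj (kernel_self_pos hα hτ1) hτ1.le hD hβ
      (fun v hv w hw => (hβB v w).trans ?_) hML hM (hC _ ⟨hnode0, hnode.2⟩) hK
      (le_add_of_nonneg_right hη.le) ?_ ?_ (hu 0 zero_lt_one)
    · calc B * (‖v‖ * ‖w‖) ≤ B * ((p * ‖v.snd‖) * (p * ‖w.snd‖)) := by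
            gcongr
            · exact hPoinc v hv
            · exact hPoinc w hw
        _ = D * (‖v.snd‖ * ‖w.snd‖) := by ring
    · rw [hker]
      linarith
    · linarith
  · exact existsUnique_isSchemeStep_of_two_le hinj hb hΩ hα hT hδ hN
      (fun s hs => hm₀.trans_le (hM s hs)) (by omega) hn u
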